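/- Let $K$ be a field of characteristic $0$ and let $n\ge 3$. A multigraph on the vertex set $[n]=\{1,\dots,n\}$ is a map $m$ assigning to every pair $\{i,j\}$ of distinct vertices a multiplicity $m_{\{i,j\}}\in\mathbb N$; the pairs with $m_{\{i,j\}}\neq 0$ are its edges, and a simple graph is identified with the multigraph with multiplicities $0$ and $1$. In the polynomial ring $K[x_{\{i,j\}}]$ (one variable for each pair of distinct vertices), put $x^m=\prod x_{\{i,j\}}^{m_{\{i,j\}}}$ and $s(m)=\sum_{m'}x^{m'}$, where $m'$ runs through the (distinct) multigraphs on $[n]$ isomorphic to $m$. Let $\mathcal R_n$ be the $K$-subalgebra generated by the $s(m)$ for the multigraphs $m$ on $[n]$ that have at least one isolated vertex. The multigraph $m$ is called algebraically reconstructible if $s(m)\in\mathcal R_n$. An octopus is a tree with a vertex $h$ (the head) that is a union of paths starting at $h$, any two of which have only $h$ in common. A starred octopus is a tree obtained from an octopus by attaching stars (trees of diameter $2$) to the head: it has a vertex $h$ and is a union of subgraphs, any two of which have only the vertex $h$ in common, each being either a path starting at $h$ or a star containing $h$. Then: 1. every multigraph on $[n]$ all of whose edges are incident to one common vertex is algebraically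 reconstructible; 2. every octopus on $[n]$ is algebraically reconstructible; 3. every starred octopus on $[n]$ is algebraically reconstructible; 4. every finite tree of diameter at most $4$ is a starred octopus. -/

import Mathlib

noncomputable section

namespace AlgRec

/-- The pairs `{i, j}` of two distinct elements of the vertex set (here `Fin n`). -/
abbrev Edge (n : ℕ) : Type := {e : Sym2 (Fin n) // ¬ e.IsDiag}

/-- A multigraph on the vertex set `Fin n`: a natural number (the multiplicity) for each pair. -/
abbrev Multigraph (n : ℕ) : Type := Edge n → ℕ

/-- The action of a permutation of the vertices on the pairs, `{i, j} ↦ {σ i, σ j}`. -/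
def permEdge {n : ℕ} (σ : Equiv.Perm (Fin n)) (e : Edge n) : Edge n :=
  ⟨Sym2.map σ e.1, fun h => e.2 ((Sym2.isDiag_map σ.injective).1 h)⟩

/-- The action of the symmetric group on multigraphs,
`(σ • m) {i, j} = m {σ⁻¹ i, σ⁻¹ j}`. -/
def permGraph {n : ℕ} (σ : Equiv.Perm (Fin n)) (m : Multigraph n) : Multigraph n :=
  fun e => m (permEdge σ⁻¹ e)

/-- The orbit of `m`: the finite set of all multigraphs on `Fin n` isomorphic to `m`. -/
def orbit {n : ℕ} (m : Multigraph n) : Finset (Multigraph n) :=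
  Finset.univ.image fun σ : Equiv.Perm (Fin n) => permGraph σ m

/-- The monomial `∏ x_{i,j} ^ m_{i,j}` of a multigraph. -/
def graphMonomial (K : Type*) [Field K] {n : ℕ} (m : Multigraph n) :
    MvPolynomial (Edge n) K :=
  ∏ e : Edge n, MvPolynomial.X e ^ m e

/-- The invariant polynomial of `m`: the sum of the monomials of the multigraphs in its orbit. -/
def graphInvariant (K : Type*) [Field K] {n : ℕ} (m : Multigraph n) :
    MvPolynomial (Edge n) K :=
  ∑ m' ∈ orbit m, graphMonomial K m'

/-- The vertex `v` is isolated in `m`: no pair containing `v` has positive multiplicity. -/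
def IsIsolated {n : ℕ} (m : Multigraph n) (v : Fin n) : Prop :=
  ∀ e : Edge n, v ∈ e.1 → m e = 0

/-- The algebra of algebraically reconstructible polynomials: the algebra generated by the
invariant polynomials of the multigraphs with at least one isolated vertex. -/
def reconstructibleAlgebra (K : Type*) [Field K] (n : ℕ) :
    Subalgebra K (MvPolynomial (Edge n) K) :=
  Algebra.adjoin K
    {p | ∃ m : Multigraph n, (∃ v : Fin n, IsIsolated m v) ∧ p = graphInvariant K m}

/-- A multigraph is algebraically reconstructible (over `K`) if its invariant polynomial is. -/
def IsAlgReconstructible (K : Type*) [Field K] {n : ℕ} (m : Multigraph n) : Prop :=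
  graphInvariant K m ∈ reconstructibleAlgebra K n

open Classical in
/-- A simple graph, seen as the multigraph with multiplicities `1` (edge) and `0` (non-edge). -/
def ofSimpleGraph {n : ℕ} (G : SimpleGraph (Fin n)) : Multigraph n :=
  fun e => if e.1 ∈ G.edgeSet then 1 else 0

/-- `G` is the union of the subgraphs in `𝓑`, any two of which have only the vertex `h`
in common. -/
def IsGluedAt {V : Type*} {G : SimpleGraph V} (h : V) (𝓑 : Set G.Subgraph) : Prop :=
  𝓑.Pairwise (fun B C => B.verts ∩ C.verts = {h}) ∧ sSup 𝓑 = ⊤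

/-- The subgraph `B` is a path starting at the vertex `h`. -/
def IsPathFrom {V : Type*} {G : SimpleGraph V} (h : V) (B : G.Subgraph) : Prop :=
  ∃ (u : V) (p : G.Walk h u), p.IsPath ∧ B = p.toSubgraph

/-- The subgraph `B` is a star (a tree of diameter `2`) containing the vertex `h`. -/
def IsStarThrough {V : Type*} {G : SimpleGraph V} (h : V) (B : G.Subgraph) : Prop :=
  h ∈ B.verts ∧ B.coe.IsTree ∧ B.coe.diam = 2

/-- An octopus: a tree composed of paths issuing from one vertex, the head. -/
def IsOctopus {V : Type*} (G : SimpleGraph V) : Prop :=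
  G.IsTree ∧ ∃ (h : V) (𝓑 : Set G.Subgraph),
    IsGluedAt h 𝓑 ∧ ∀ B ∈ 𝓑, IsPathFrom h B

/-- A starred octopus: an octopus to whose head stars have been attached, so a tree composed of
paths issuing from the head and of stars containing the head. -/
def IsStarredOctopus {V : Type*} (G : SimpleGraph V) : Prop :=
  G.IsTree ∧ ∃ (h : V) (𝓑 : Set G.Subgraph),
    IsGluedAt h 𝓑 ∧ ∀ B ∈ 𝓑, IsPathFrom h B ∨ IsStarThrough h B

end AlgRec

end

namespace AlgRec

open Finset

/-! ### Vertex permutations acting on multigraphs, and non-isolated vertices -/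

section Permutations

variable {n : ℕ}

/-! The proof works with rooted objects. A pair `(m, h)` gives a function from vertices to
polynomials, `rootedSum`, whose values add up to a nonzero multiple of the invariant of `m`. These
functions multiply pointwise, and multiplying corresponds to gluing multigraphs at the root, up to
terms where the two factors overlap elsewhere and which therefore have fewer vertices.

Two spaces of functions have total sums in the reconstructible algebra: `deckSpan`, because a root
isolated in `m` makes the generator available, and `lowSpan` below order `n - 1`, because some
vertex is left over. A rooted multigraph is `Good` if its rooted sum lies in `deckSpan` modulo fewer
vertices, and a multigraph good at some root is reconstructible. As `deckSpan` is closed under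
products, goodness survives gluing at the root (`Good.add`).

Good pieces come from `good_of_forall`: summing the rooted sums of `m` over all roots gives a
constant function, which lies in `deckSpan` when `m` has an isolated vertex; so one root can be
solved for once all inequivalent ones are good. For an edge the two ends are equivalent; edges glue
to stars rooted at the centre, and the leaves follow. For a path, interior roots split it into
shorter paths, and the two ends are equivalent. Gluing these pieces gives starred octopuses; a block
that already spans everything is instead rooted at an interior vertex or at its centre.

For trees of diameter at most `4`, a middle vertex of a longest path is within distance `2` of
everything, and the stars around its neighbours are the blocks. -/

theorem permEdge_mul (σ τ : Equiv.Perm (Fin n)) (e : Edge n) :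
    permEdge (σ * τ) e = permEdge σ (permEdge τ e) :=
  Subtype.ext (by simp [permEdge, Sym2.map_map])

theorem permEdge_one (e : Edge n) : permEdge 1 e = e :=
  Subtype.ext (by simp [permEdge])

theorem permEdge_inv_permEdge (σ : Equiv.Perm (Fin n)) (e : Edge n) :
    permEdge σ⁻¹ (permEdge σ e) = e := by
  rw [← permEdge_mul, inv_mul_cancel, permEdge_one]

theorem permEdge_permEdge_inv (σ : Equiv.Perm (Fin n)) (e : Edge n) :
    permEdge σ (permEdge σ⁻¹ e) = e := by
  rw [← permEdge_mul, mul_inv_cancel, permEdge_one]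

theorem mem_permEdge {σ : Equiv.Perm (Fin n)} {e : Edge n} {v : Fin n} :
    v ∈ (permEdge σ e).1 ↔ σ⁻¹ v ∈ e.1 := by
  simp only [permEdge, Sym2.mem_map]
  constructor
  · rintro ⟨a, ha, rfl⟩
    simpa using ha
  · exact fun h => ⟨_, h, by simp⟩

theorem permGraph_mul (σ τ : Equiv.Perm (Fin n)) (m : Multigraph n) :
    permGraph (σ * τ) m = permGraph σ (permGraph τ m) := by
  funext e
  simp [permGraph, permEdge_mul]

theorem permGraph_one (m : Multigraph n) : permGraph 1 m = m := by
  funext e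
  simp [permGraph, permEdge_one]

theorem permGraph_add (σ : Equiv.Perm (Fin n)) (m m' : Multigraph n) :
    permGraph σ (m + m') = permGraph σ m + permGraph σ m' := rfl

theorem permGraph_sum {ι : Type*} (σ : Equiv.Perm (Fin n)) (s : Finset ι)
    (m : ι → Multigraph n) :
    permGraph σ (∑ i ∈ s, m i) = ∑ i ∈ s, permGraph σ (m i) := by
  funext e
  simp [permGraph]

open Classical in
/-- The finite set of the vertices of `m` that are not isolated. -/
noncomputable def graphVerts (m : Multigraph n) : Finset (Fin n) :=
  univ.filter fun v => ¬ IsIsolated m v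

theorem notMem_graphVerts {m : Multigraph n} {v : Fin n} :
    v ∉ graphVerts m ↔ IsIsolated m v := by
  simp [graphVerts]

theorem mem_graphVerts {m : Multigraph n} {v : Fin n} :
    v ∈ graphVerts m ↔ ∃ e : Edge n, v ∈ e.1 ∧ m e ≠ 0 := by
  simp [graphVerts, IsIsolated]

theorem graphVerts_add (m m' : Multigraph n) :
    graphVerts (m + m') = graphVerts m ∪ graphVerts m' := by
  ext v
  simp only [mem_graphVerts, mem_union, Pi.add_apply, ne_eq, Nat.add_eq_zero_iff, not_and_or]
  grind

theorem graphVerts_zero : graphVerts (0 : Multigraph n) = ∅ := by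
  ext v
  simp [mem_graphVerts]

theorem graphVerts_sum {ι : Type*} [DecidableEq ι] (s : Finset ι) (m : ι → Multigraph n) :
    graphVerts (∑ i ∈ s, m i) = s.biUnion fun i => graphVerts (m i) := by
  induction s using Finset.induction_on with
  | empty => simp [graphVerts_zero]
  | insert i s hi ih => rw [sum_insert hi, graphVerts_add, ih, biUnion_insert]

theorem mem_graphVerts_permGraph {σ : Equiv.Perm (Fin n)} {m : Multigraph n} {v : Fin n} :
    v ∈ graphVerts (permGraph σ m) ↔ σ⁻¹ v ∈ graphVerts m := by
  simp only [mem_graphVerts, permGraph]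
  constructor
  · rintro ⟨e, he, hm⟩
    exact ⟨_, by simpa [mem_permEdge] using he, hm⟩
  · rintro ⟨e, he, hm⟩
    exact ⟨permEdge σ e, mem_permEdge.2 he, by rwa [permEdge_inv_permEdge]⟩

theorem graphVerts_permGraph (σ : Equiv.Perm (Fin n)) (m : Multigraph n) :
    graphVerts (permGraph σ m) = (graphVerts m).image σ := by
  ext v
  rw [mem_graphVerts_permGraph, mem_image]
  exact ⟨fun h => ⟨_, h, by simp⟩, by rintro ⟨a, ha, rfl⟩; simpa using ha⟩

/-- This allows a permutation to be replaced by any other extension of its restriction to the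
non-isolated vertices. -/
theorem permGraph_congr {σ τ : Equiv.Perm (Fin n)} {m : Multigraph n}
    (h : ∀ v ∈ graphVerts m, σ v = τ v) : permGraph σ m = permGraph τ m := by
  have key : ∀ e : Edge n, m e ≠ 0 → permEdge σ e = permEdge τ e := fun e he =>
    Subtype.ext (Sym2.map_congr fun v hv => h v (mem_graphVerts.2 ⟨e, hv, he⟩))
  funext e
  simp only [permGraph]
  by_cases h1 : m (permEdge σ⁻¹ e) = 0
  · by_contra h2
    have h3 := key (permEdge τ⁻¹ e) (fun h0 => h2 (by rw [h1, h0]))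
    rw [permEdge_permEdge_inv] at h3
    apply h2
    conv_lhs => rw [← h3, permEdge_inv_permEdge]
  · have h3 := key _ h1
    rw [permEdge_permEdge_inv] at h3
    conv_rhs => rw [h3, permEdge_inv_permEdge]

theorem exists_perm_eqOn {α : Type*} [Finite α] {s : Set α} {f : α → α} (hf : Set.InjOn f s) :
    ∃ π : Equiv.Perm α, ∀ x ∈ s, π x = f x := by
  obtain ⟨π, hπ⟩ := Equiv.Perm.exists_extending_pair (fun x : s => (x : α)) (fun x : s => f x)
    Subtype.val_injective hf.injective
  exact ⟨π, fun x hx => hπ ⟨x, hx⟩⟩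

/-- The number of vertices of `m` other than `h` that are not isolated. -/
noncomputable def coCard (m : Multigraph n) (h : Fin n) : ℕ := ((graphVerts m).erase h).card

theorem coCard_permGraph (σ : Equiv.Perm (Fin n)) (m : Multigraph n) (h : Fin n) :
    coCard (permGraph σ m) (σ h) = coCard m h := by
  rw [coCard, coCard, graphVerts_permGraph, ← image_erase σ.injective,
    card_image_of_injective _ σ.injective]

theorem coCard_add_le (m m' : Multigraph n) (h : Fin n) :
    coCard (m + m') h ≤ coCard m h + coCard m' h := by
  rw [coCard, graphVerts_add, erase_union_distrib]
  exact card_union_le _ _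

theorem coCard_lt (m : Multigraph n) (h : Fin n) : coCard m h < n := by
  have : ((graphVerts m).erase h).card < (univ : Finset (Fin n)).card :=
    card_lt_card ⟨subset_univ _, fun hh => by simpa using hh (mem_univ h)⟩
  simpa [coCard] using this

end Permutations

/-! ### Sums over the symmetric group and their rooted versions -/

section Symmetrization

variable (K : Type*) [Field K] {n : ℕ}

theorem graphMonomial_add (m m' : Multigraph n) :
    graphMonomial K (m + m') = graphMonomial K m * graphMonomial K m' := by
  simp [graphMonomial, pow_add, prod_mul_distrib]

theorem graphMonomial_zero : graphMonomial K (0 : Multigraph n) = 1 := by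
  simp [graphMonomial]

/-- The sum of the monomials of all images of `m` under the symmetric group. -/
noncomputable def symSum (m : Multigraph n) : MvPolynomial (Edge n) K :=
  ∑ σ : Equiv.Perm (Fin n), graphMonomial K (permGraph σ m)

/-- Orbit-stabilizer: each fibre of `σ ↦ permGraph σ m` over the orbit is a coset of the stabilizer
of `m`. In characteristic `0` its order is invertible, so `symSum` can replace the invariant. -/
theorem symSum_eq (m : Multigraph n) :
    symSum K m =
      ((univ.filter fun σ : Equiv.Perm (Fin n) => permGraph σ m = m).card : K) •
        graphInvariant K m := by
  rw [symSum, graphInvariant, smul_sum,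
    ← sum_fiberwise_of_maps_to (t := orbit m) (g := fun σ => permGraph σ m)
      (fun σ _ => mem_image_of_mem _ (mem_univ σ))]
  refine sum_congr rfl fun m' hm' => ?_
  obtain ⟨τ, -, rfl⟩ := mem_image.1 hm'
  rw [sum_congr rfl (g := fun _ => graphMonomial K (permGraph τ m))
    (fun σ hσ => by rw [(mem_filter.1 hσ).2]), sum_const, ← Nat.cast_smul_eq_nsmul K]
  congr 2
  refine card_bij (fun σ _ => τ⁻¹ * σ) ?_ (fun _ _ _ _ h => mul_left_cancel h) ?_
  · intro σ hσ
    have := (mem_filter.1 hσ).2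
    refine mem_filter.2 ⟨mem_univ _, ?_⟩
    rw [permGraph_mul, this, ← permGraph_mul, inv_mul_cancel, permGraph_one]
  · intro σ hσ
    have := (mem_filter.1 hσ).2
    exact ⟨τ * σ, mem_filter.2 ⟨mem_univ _, by rw [permGraph_mul, this]⟩, by group⟩

theorem isAlgReconstructible_iff_symSum_mem [CharZero K] (m : Multigraph n) :
    IsAlgReconstructible K m ↔ symSum K m ∈ reconstructibleAlgebra K n := by
  have hc : ((univ.filter fun σ : Equiv.Perm (Fin n) => permGraph σ m = m).card : K) ≠ 0 :=
    Nat.cast_ne_zero.2 (card_ne_zero_of_mem (mem_filter.2 ⟨mem_univ 1, permGraph_one m⟩))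
  rw [symSum_eq, IsAlgReconstructible]
  refine ⟨fun h => Subalgebra.smul_mem _ h _, fun h => ?_⟩
  have := Subalgebra.smul_mem _ h
    ((univ.filter fun σ : Equiv.Perm (Fin n) => permGraph σ m = m).card : K)⁻¹
  rwa [smul_smul, inv_mul_cancel₀ hc, one_smul] at this

theorem symSum_mem_of_isIsolated [CharZero K] {m : Multigraph n} {v : Fin n}
    (hv : IsIsolated m v) : symSum K m ∈ reconstructibleAlgebra K n :=
  (isAlgReconstructible_iff_symSum_mem K m).1 (Algebra.subset_adjoin ⟨m, ⟨v, hv⟩, rfl⟩)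

/-- The rooted version of `symSum`: to the vertex `v`, attach the sum of the monomials of the
images of `m` under the permutations that map the root `h` to `v`. -/
noncomputable def rootedSum (m : Multigraph n) (h : Fin n) : Fin n → MvPolynomial (Edge n) K :=
  fun v => ∑ σ : Equiv.Perm (Fin n) with σ h = v, graphMonomial K (permGraph σ m)

theorem sum_rootedSum_apply (m : Multigraph n) (h : Fin n) :
    ∑ v, rootedSum K m h v = symSum K m :=
  sum_fiberwise univ (fun σ : Equiv.Perm (Fin n) => σ h) _

/-- For a fixed `v`, each `σ` occurs for exactly one root, namely `σ⁻¹ v`; hence the sum does not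
depend on `v`. -/
theorem sum_rootedSum (m : Multigraph n) :
    ∑ h, rootedSum K m h = fun _ => symSum K m := by
  funext v
  rw [Finset.sum_apply, symSum, ← sum_fiberwise univ (fun σ : Equiv.Perm (Fin n) => σ⁻¹ v)]
  refine sum_congr rfl fun h _ => sum_congr (filter_congr fun σ _ => ?_) fun _ _ => rfl
  rw [Equiv.Perm.inv_eq_iff_eq, eq_comm]

theorem rootedSum_permGraph (π : Equiv.Perm (Fin n)) (m : Multigraph n) (h : Fin n) :
    rootedSum K (permGraph π m) (π h) = rootedSum K m h := by
  funext v
  refine sum_bij (fun σ _ => σ * π) (fun σ hσ => ?_) (fun _ _ _ _ h => mul_right_cancel h)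
    (fun σ hσ => ⟨σ * π⁻¹, ?_, by group⟩) fun σ _ => by rw [permGraph_mul]
  · simpa using hσ
  · simpa using hσ

theorem rootedSum_eq_of_permGraph_eq {π : Equiv.Perm (Fin n)} {m : Multigraph n} {h : Fin n}
    (hπ : permGraph π m = m) : rootedSum K m (π h) = rootedSum K m h := by
  conv_lhs => rw [← hπ]
  exact rootedSum_permGraph K π m h

/-- Two permutations that send `h` to the same vertex differ by a `τ` fixing `h`, so the product
runs over all ways of superposing `m'` on `m` at the root. -/
theorem rootedSum_mul (m m' : Multigraph n) (h : Fin n) :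
    rootedSum K m h * rootedSum K m' h =
      ∑ τ : Equiv.Perm (Fin n) with τ h = h, rootedSum K (m + permGraph τ m') h := by
  funext v
  rw [Pi.mul_apply, Finset.sum_apply]
  simp only [rootedSum]
  rw [sum_mul_sum]
  conv_rhs => rw [sum_comm]
  refine sum_congr rfl fun σ hσ => ?_
  have hσ : σ h = v := (mem_filter.1 hσ).2
  subst hσ
  refine sum_bij (fun τ _ => σ⁻¹ * τ) (fun τ hτ => ?_) (fun _ _ _ _ h => mul_left_cancel h)
    (fun τ hτ => ⟨σ * τ, ?_, by group⟩) fun τ _ => ?_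
  · simp [(mem_filter.1 hτ).2]
  · simp [(mem_filter.1 hτ).2]
  · rw [permGraph_add, graphMonomial_add, ← permGraph_mul]
    congr 3
    group

end Symmetrization

/-! ### Good rooted multigraphs and gluing at the root -/

section Good

variable (K : Type*) [Field K] {n : ℕ}

/-- The functions on the vertices that are combinations, with algebraically reconstructible
coefficients, of functions whose value at `v` is a polynomial of the graph without `v`. -/
noncomputable def deckSpan (n : ℕ) : Submodule K (Fin n → MvPolynomial (Edge n) K) :=
  Submodule.span K {f | ∃ r ∈ reconstructibleAlgebra K n, ∃ (m : Multigraph n) (u : Fin n),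
    IsIsolated m u ∧ f = (fun _ => r) * rootedSum K m u}

/-- The span of the rooted sums whose multigraphs have less than `k` vertices besides the root. -/
noncomputable def lowSpan (n k : ℕ) : Submodule K (Fin n → MvPolynomial (Edge n) K) :=
  Submodule.span K {f | ∃ (m : Multigraph n) (u : Fin n), coCard m u < k ∧ f = rootedSum K m u}

variable {K}

theorem sum_mem_of_mem_deckSpan [CharZero K] {f : Fin n → MvPolynomial (Edge n) K}
    (hf : f ∈ deckSpan K n) : ∑ v, f v ∈ reconstructibleAlgebra K n := by
  induction hf using Submodule.span_induction with
  | mem f hf =>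
    obtain ⟨r, hr, m, u, hu, rfl⟩ := hf
    simp only [Pi.mul_apply]
    rw [← mul_sum, sum_rootedSum_apply]
    exact mul_mem hr (symSum_mem_of_isIsolated K hu)
  | zero => simp
  | add f g _ _ hf hg => simpa [sum_add_distrib] using add_mem hf hg
  | smul a f _ hf => simpa [← smul_sum] using Subalgebra.smul_mem _ hf a

theorem sum_mem_of_mem_lowSpan [CharZero K] {f : Fin n → MvPolynomial (Edge n) K}
    (hf : f ∈ lowSpan K n (n - 1)) : ∑ v, f v ∈ reconstructibleAlgebra K n := by
  induction hf using Submodule.span_induction with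
  | mem f hf =>
    obtain ⟨m, u, hu, rfl⟩ := hf
    rw [sum_rootedSum_apply]
    obtain ⟨v, hv⟩ : ∃ v, v ∉ graphVerts m := by
      by_contra! h
      rw [coCard, eq_univ_iff_forall.2 h] at hu
      simp at hu
    exact symSum_mem_of_isIsolated K (notMem_graphVerts.1 hv)
  | zero => simp
  | add f g _ _ hf hg => simpa [sum_add_distrib] using add_mem hf hg
  | smul a f _ hf => simpa [← smul_sum] using Subalgebra.smul_mem _ hf a

theorem rootedSum_mem_deckSpan {m : Multigraph n} {u : Fin n} (hu : IsIsolated m u) :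
    rootedSum K m u ∈ deckSpan K n :=
  Submodule.subset_span ⟨1, one_mem _, m, u, hu, by ext; simp⟩

/-- Every vertex is isolated in the empty multigraph, and its rooted sums over all roots add up to
the constant `n!`. -/
theorem const_mem_deckSpan [CharZero K] {r : MvPolynomial (Edge n) K}
    (hr : r ∈ reconstructibleAlgebra K n) : (fun _ => r) ∈ deckSpan K n := by
  have h1 : (∑ u : Fin n, (fun _ => r) * rootedSum K (0 : Multigraph n) u) ∈ deckSpan K n :=
    sum_mem fun u _ => Submodule.subset_span ⟨r, hr, 0, u, fun _ _ => rfl, rfl⟩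
  have hc : ((Fintype.card (Equiv.Perm (Fin n)) : ℕ) : K) ≠ 0 :=
    Nat.cast_ne_zero.2 Fintype.card_ne_zero
  have h2 := Submodule.smul_mem _ ((Fintype.card (Equiv.Perm (Fin n)) : ℕ) : K)⁻¹ h1
  rw [← mul_sum, sum_rootedSum] at h2
  convert h2 using 1
  funext v
  have : symSum K (0 : Multigraph n) = ((Fintype.card (Equiv.Perm (Fin n)) : ℕ) : K) • 1 := by
    have h0 : ∀ σ ∈ univ, graphMonomial K (permGraph σ (0 : Multigraph n)) = 1 :=
      fun _ _ => graphMonomial_zero K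
    rw [symSum, sum_congr rfl h0, sum_const, Nat.cast_smul_eq_nsmul K, card_univ]
  simp only [Pi.smul_apply, Pi.mul_apply, this]
  rw [mul_smul_comm, smul_smul, inv_mul_cancel₀ hc, mul_one, one_smul]

/-- Once both factors have the same root `u`, isolated in each, every superposition by a `τ` fixing
`u` still has `u` isolated. -/
theorem deckSpan_mul_mem {f g : Fin n → MvPolynomial (Edge n) K}
    (hf : f ∈ deckSpan K n) (hg : g ∈ deckSpan K n) : f * g ∈ deckSpan K n := by
  suffices h : deckSpan K n * deckSpan K n ≤ deckSpan K n from h (Submodule.mul_mem_mul hf hg)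
  conv_lhs => rw [deckSpan, Submodule.span_mul_span]
  rw [Submodule.span_le]
  rintro _ ⟨_, ⟨r, hr, m, u, hu, rfl⟩, _, ⟨r', hr', m', u', hu', rfl⟩, rfl⟩
  obtain ⟨m'', he, hi⟩ : ∃ m'', rootedSum K m' u' = rootedSum K m'' u ∧ IsIsolated m'' u := by
    refine ⟨permGraph (Equiv.swap u' u) m', ?_, ?_⟩
    · rw [← rootedSum_permGraph K (Equiv.swap u' u) m', Equiv.swap_apply_left]
    · rw [← notMem_graphVerts, mem_graphVerts_permGraph]
      simpa [notMem_graphVerts] using hu'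
  have heq : (fun _ => r) * rootedSum K m u * ((fun _ => r') * rootedSum K m' u') =
      ∑ τ : Equiv.Perm (Fin n) with τ u = u,
        (fun _ => r * r') * rootedSum K (m + permGraph τ m'') u := by
    rw [← mul_sum, ← rootedSum_mul, he]
    funext v
    simp only [Pi.mul_apply]
    ring
  change (fun _ => r) * rootedSum K m u * ((fun _ => r') * rootedSum K m' u') ∈ deckSpan K n
  rw [heq]
  refine sum_mem fun τ hτ => Submodule.subset_span ⟨_, mul_mem hr hr', _, u, ?_, rfl⟩
  have hτ : τ⁻¹ u = u := by
    rw [Equiv.Perm.inv_eq_iff_eq]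
    exact (mem_filter.1 hτ).2.symm
  rw [← notMem_graphVerts, graphVerts_add, mem_union, mem_graphVerts_permGraph, hτ, not_or]
  exact ⟨notMem_graphVerts.2 hu, notMem_graphVerts.2 hi⟩

theorem lowSpan_mul_mem {a b : ℕ} {f g : Fin n → MvPolynomial (Edge n) K}
    (hf : f ∈ lowSpan K n (a + 1)) (hg : g ∈ lowSpan K n b) : f * g ∈ lowSpan K n (a + b) := by
  suffices h : lowSpan K n (a + 1) * lowSpan K n b ≤ lowSpan K n (a + b) from
    h (Submodule.mul_mem_mul hf hg)
  rw [lowSpan, lowSpan, Submodule.span_mul_span, Submodule.span_le]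
  rintro _ ⟨_, ⟨m, u, hu, rfl⟩, _, ⟨m', u', hu', rfl⟩, rfl⟩
  have he : rootedSum K m' u' = rootedSum K (permGraph (Equiv.swap u' u) m') u := by
    rw [← rootedSum_permGraph K (Equiv.swap u' u) m', Equiv.swap_apply_left]
  have hc : coCard (permGraph (Equiv.swap u' u) m') u = coCard m' u' := by
    rw [← coCard_permGraph (Equiv.swap u' u) m', Equiv.swap_apply_left]
  change rootedSum K m u * rootedSum K m' u' ∈ lowSpan K n (a + b)
  rw [he, rootedSum_mul]
  refine sum_mem fun τ hτ => Submodule.subset_span ⟨_, u, ?_, rfl⟩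
  have hτ : coCard (permGraph τ (permGraph (Equiv.swap u' u) m')) u = coCard m' u' := by
    have h1 := coCard_permGraph τ (permGraph (Equiv.swap u' u) m') u
    rwa [(mem_filter.1 hτ).2, hc] at h1
  have := coCard_add_le m (permGraph τ (permGraph (Equiv.swap u' u) m')) u
  omega

variable (K) in
/-- The rooted sum of `(m, h)` belongs to `deckSpan`, up to rooted sums of multigraphs with fewer
vertices. -/
def Good (m : Multigraph n) (h : Fin n) : Prop :=
  ∃ b ∈ deckSpan K n, rootedSum K m h - b ∈ lowSpan K n (coCard m h)

theorem lowSpan_mono {a b : ℕ} (hab : a ≤ b) : lowSpan K n a ≤ lowSpan K n b :=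
  Submodule.span_mono fun _ ⟨m, u, hu, hf⟩ => ⟨m, u, hu.trans_le hab, hf⟩

theorem Good.isAlgReconstructible [CharZero K] {m : Multigraph n} {h : Fin n}
    (hm : Good K m h) : IsAlgReconstructible K m := by
  obtain ⟨b, hb, hl⟩ := hm
  have hc := coCard_lt m h
  -- Since `coCard m h ≤ n - 1`, the error terms have at most `n - 2` vertices besides the root and
  -- so miss a vertex.
  have h1 := sum_mem_of_mem_lowSpan (lowSpan_mono (by omega) hl)
  have h2 := add_mem h1 (sum_mem_of_mem_deckSpan hb)
  rw [← sum_add_distrib] at h2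
  simp only [Pi.sub_apply, sub_add_cancel] at h2
  rwa [sum_rootedSum_apply, ← isAlgReconstructible_iff_symSum_mem] at h2

theorem good_of_isIsolated {m : Multigraph n} {h : Fin n} (hm : IsIsolated m h) : Good K m h :=
  ⟨_, rootedSum_mem_deckSpan hm, by simp⟩

/-- In the product of the two rooted sums, the superpositions meeting only at the root all have the
rooted sum of `m + m'`; the others lose a vertex. Replacing both factors by their approximations in
`deckSpan` changes the product only by lower terms. -/
theorem Good.add [CharZero K] {m m' : Multigraph n} {h : Fin n} (hm : Good K m h)
    (hm' : Good K m' h) (hd : ∀ v ∈ graphVerts m, v ∈ graphVerts m' → v = h) :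
    Good K (m + m') h := by
  obtain ⟨b, hb, hl⟩ := hm
  obtain ⟨b', hb', hl'⟩ := hm'
  have hcard : coCard (m + m') h = coCard m h + coCard m' h := by
    rw [coCard, graphVerts_add, erase_union_distrib, card_union_of_disjoint]
    · rfl
    · exact disjoint_left.2 fun v h1 h2 =>
        (mem_erase.1 h1).1 (hd v (mem_erase.1 h1).2 (mem_erase.1 h2).2)
  set ρ := rootedSum K m h with hρ
  set ρ' := rootedSum K m' h with hρ'
  have hρl : ρ ∈ lowSpan K n (coCard m h + 1) :=
    Submodule.subset_span ⟨m, h, Nat.lt_succ_self _, rfl⟩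
  have hρl' : ρ' ∈ lowSpan K n (coCard m' h + 1) :=
    Submodule.subset_span ⟨m', h, Nat.lt_succ_self _, rfl⟩
  have hbl : b ∈ lowSpan K n (coCard m h + 1) := by
    have := sub_mem hρl (lowSpan_mono (Nat.le_succ _) hl)
    rwa [sub_sub_cancel] at this
  -- The difference is `b * (ρ' - b') + ρ' * (ρ - b)`.
  have h1 : ρ * ρ' - b * b' ∈ lowSpan K n (coCard (m + m') h) := by
    have h2 := lowSpan_mul_mem hbl hl'
    have h3 := lowSpan_mul_mem hρl' hl
    rw [add_comm] at h3
    rw [hcard]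
    convert add_mem h2 h3 using 1
    ring
  let p : Equiv.Perm (Fin n) → Prop := fun τ =>
    rootedSum K (m + permGraph τ m') h = rootedSum K (m + m') h
  classical
  have h4 : ∀ τ : Equiv.Perm (Fin n), τ h = h → ¬ p τ →
      rootedSum K (m + permGraph τ m') h ∈ lowSpan K n (coCard (m + m') h) := by
    intro τ hτ hp
    refine Submodule.subset_span ⟨_, h, ?_, rfl⟩
    by_contra hlt
    apply hp
    have hτc : coCard (permGraph τ m') h = coCard m' h := by
      conv_lhs => rw [← hτ]
      exact coCard_permGraph τ m' h
    have hdis : ∀ v ∈ graphVerts m, ∀ w ∈ graphVerts m', v = τ w → v = h := by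
      intro v hv w hw hvw
      by_contra hne
      have h5 := card_union_add_card_inter ((graphVerts m).erase h)
        ((graphVerts (permGraph τ m')).erase h)
      rw [← erase_union_distrib, ← graphVerts_add] at h5
      have h6 : 0 < ((graphVerts m).erase h ∩ (graphVerts (permGraph τ m')).erase h).card := by
        refine card_pos.2 ⟨v, ?_⟩
        simp only [mem_inter, mem_erase, graphVerts_permGraph, mem_image]
        exact ⟨⟨hne, hv⟩, hne, w, hw, hvw.symm⟩
      unfold coCard at *
      omega
    -- Without overlap outside `h`, the identity on `m` and `τ` on `m'` combine to an injective map;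
    -- extended to a permutation, it carries `m + m'` to `m + permGraph τ m'` and fixes the root.
    obtain ⟨π, hπ⟩ := exists_perm_eqOn (s := ↑(insert h (graphVerts m ∪ graphVerts m')))
      (f := fun v => if v ∈ graphVerts m then v else τ v) (by
        intro x hx y hy hxy
        have hti := τ.injective (a₁ := x) (a₂ := y)
        have hti1 := τ.injective (a₁ := x) (a₂ := h)
        have hti2 := τ.injective (a₁ := y) (a₂ := h)
        simp only [coe_insert, coe_union, Set.mem_insert_iff, Set.mem_union, mem_coe] at hx hy
        grind)
    have hπh : π h = h := by simp [hπ, hτ]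
    have e1 : permGraph π m = m := by
      conv_rhs => rw [← permGraph_one m]
      exact permGraph_congr fun v hv => by simp [hπ v (by simp [hv]), hv]
    have e2 : permGraph π m' = permGraph τ m' :=
      permGraph_congr fun v hv => by
        rw [hπ v (by simp [hv])]
        split_ifs with hvm
        · rw [hd v hvm hv, hτ]
        · rfl
    change _ = _
    rw [← e2, ← rootedSum_permGraph K π (m + m') h, hπh, permGraph_add, e1]
  set N : ℕ := (univ.filter fun τ : Equiv.Perm (Fin n) => τ h = h ∧ p τ).card with hN
  have hN0 : (N : K) ≠ 0 := Nat.cast_ne_zero.2 (card_ne_zero_of_mem (mem_filter.2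
    ⟨mem_univ 1, rfl, by simp only [p, permGraph_one]⟩))
  have h7 : ρ * ρ' - (N : K) • rootedSum K (m + m') h ∈ lowSpan K n (coCard (m + m') h) := by
    rw [hρ, hρ', rootedSum_mul, ← sum_filter_add_sum_filter_not _ p, filter_filter,
      sum_congr rfl (g := fun _ => rootedSum K (m + m') h)
        (fun τ hτ => (mem_filter.1 hτ).2.2), sum_const, Nat.cast_smul_eq_nsmul K,
      add_sub_cancel_left, filter_filter]
    exact sum_mem fun τ hτ => h4 τ (mem_filter.1 hτ).2.1 (mem_filter.1 hτ).2.2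
  refine ⟨(N : K)⁻¹ • (b * b'), Submodule.smul_mem _ _ (deckSpan_mul_mem hb hb'), ?_⟩
  have h8 := Submodule.smul_mem _ (N : K)⁻¹ (sub_mem h1 h7)
  convert h8 using 1
  rw [sub_sub_sub_cancel_left, smul_sub, smul_smul, inv_mul_cancel₀ hN0, one_smul]

theorem good_zero (h : Fin n) : Good K (0 : Multigraph n) h :=
  good_of_isIsolated fun _ _ => rfl

theorem good_sum [CharZero K] {ι : Type*} (s : Finset ι) (m : ι → Multigraph n) {h : Fin n}
    (hm : ∀ i ∈ s, Good K (m i) h)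
    (hd : ∀ i ∈ s, ∀ j ∈ s, i ≠ j → ∀ v ∈ graphVerts (m i), v ∈ graphVerts (m j) → v = h) :
    Good K (∑ i ∈ s, m i) h := by
  classical
  induction s using Finset.induction_on with
  | empty => exact good_zero h
  | insert i s hi ih =>
    rw [sum_insert hi]
    refine (hm i (mem_insert_self _ _)).add (ih (fun j hj => hm j (mem_insert_of_mem hj))
      fun j hj k hk => hd j (mem_insert_of_mem hj) k (mem_insert_of_mem hk)) fun v hv hv' => ?_
    rw [graphVerts_sum, mem_biUnion] at hv'
    obtain ⟨j, hj, hvj⟩ := hv'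
    exact hd i (mem_insert_self _ _) j (mem_insert_of_mem hj) (fun e => hi (e ▸ hj)) v hv hvj

theorem Good.congr {m : Multigraph n} {u h : Fin n} (hm : Good K m u) (hu : u ∈ graphVerts m)
    (hh : h ∈ graphVerts m) (he : rootedSum K m u = rootedSum K m h) : Good K m h := by
  obtain ⟨b, hb, hl⟩ := hm
  refine ⟨b, hb, ?_⟩
  rw [coCard, card_erase_of_mem hu] at hl
  rwa [coCard, card_erase_of_mem hh, ← he]

/-- If `m` has an isolated vertex, it is good at a vertex `h` as soon as it is good at all other
vertices, up to those that have the same rooted sum as `h`. -/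
theorem good_of_forall [CharZero K] {m : Multigraph n} {h v : Fin n} (hv : IsIsolated m v)
    (hh : h ∈ graphVerts m)
    (hm : ∀ u ∈ graphVerts m, Good K m u ∨ rootedSum K m u = rootedSum K m h) :
    Good K m h := by
  classical
  -- The sum over all roots is a constant in the algebra, and the isolated roots contribute elements
  -- of `deckSpan`.
  have hV : ∑ u ∈ graphVerts m, rootedSum K m u ∈ deckSpan K n := by
    have h1 : ∑ u, rootedSum K m u ∈ deckSpan K n := by
      rw [sum_rootedSum]
      exact const_mem_deckSpan (symSum_mem_of_isIsolated K hv)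
    rw [← sum_add_sum_compl (graphVerts m)] at h1
    have h2 : ∑ u ∈ (graphVerts m)ᶜ, rootedSum K m u ∈ deckSpan K n :=
      sum_mem fun u hu => rootedSum_mem_deckSpan (notMem_graphVerts.1 (mem_compl.1 hu))
    simpa using sub_mem h1 h2
  let p : Fin n → Prop := fun u => rootedSum K m u = rootedSum K m h
  have hc : ∀ u ∈ graphVerts m, coCard m u = coCard m h := fun u hu => by
    rw [coCard, coCard, card_erase_of_mem hu, card_erase_of_mem hh]
  have hgood : ∀ u ∈ (graphVerts m).filter (fun u => ¬ p u),
      rootedSum K m u ∈ deckSpan K n ⊔ lowSpan K n (coCard m h) := by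
    intro u hu
    rw [mem_filter] at hu
    obtain ⟨b, hb, hl⟩ := (hm u hu.1).resolve_right hu.2
    rw [hc u hu.1] at hl
    exact Submodule.mem_sup.2 ⟨b, hb, _, hl, by ring⟩
  have hN0 : (((graphVerts m).filter p).card : K) ≠ 0 :=
    Nat.cast_ne_zero.2 (card_ne_zero_of_mem (mem_filter.2 ⟨hh, rfl⟩))
  -- Removing the good roots leaves a positive multiple of the rooted sum at `h`, by the number of
  -- roots equivalent to it.
  have h3 := Submodule.smul_mem _ (((graphVerts m).filter p).card : K)⁻¹
    (sub_mem (Submodule.mem_sup_left hV) (sum_mem hgood))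
  rw [← sum_filter_add_sum_filter_not _ p, add_sub_cancel_right,
    sum_congr rfl (g := fun _ => rootedSum K m h) (fun u hu => (mem_filter.1 hu).2), sum_const,
    ← Nat.cast_smul_eq_nsmul K, smul_smul, inv_mul_cancel₀ hN0, one_smul] at h3
  obtain ⟨b, hb, l, hl, hbl⟩ := Submodule.mem_sup.1 h3
  exact ⟨b, hb, by rw [← hbl]; simpa using hl⟩

end Good

/-! ### Goodness of edges, stars and paths -/

section Pieces

variable {n : ℕ}

/-- The multigraph whose only edge is `{x, y}`, with multiplicity `1`. -/
def edgeGraph (x y : Fin n) : Multigraph n := fun e => if e.1 = s(x, y) then 1 else 0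

theorem edgeGraph_comm (x y : Fin n) : edgeGraph x y = edgeGraph y x := by
  funext e
  simp [edgeGraph, Sym2.eq_swap]

theorem permGraph_edgeGraph (σ : Equiv.Perm (Fin n)) (x y : Fin n) :
    permGraph σ (edgeGraph x y) = edgeGraph (σ x) (σ y) := by
  funext e
  have h : (permEdge σ⁻¹ e).1 = s(x, y) ↔ e.1 = s(σ x, σ y) := by
    rw [← Sym2.map_mk, ← (Sym2.map.injective σ.injective).eq_iff (b := s(x, y)), Sym2.map_mk]
    conv_rhs => rw [← permEdge_permEdge_inv σ e]
    rfl
  simp [permGraph, edgeGraph, h]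

theorem graphVerts_smul_edgeGraph {x y : Fin n} (hxy : x ≠ y) {a : ℕ} (ha : a ≠ 0) :
    graphVerts (a • edgeGraph x y) = {x, y} := by
  ext v
  simp only [mem_graphVerts, edgeGraph, Pi.smul_apply, mem_insert, mem_singleton]
  constructor
  · rintro ⟨e, hv, he⟩
    have : e.1 = s(x, y) := by
      by_contra h
      simp [h] at he
    rw [this] at hv
    simpa using hv
  · exact fun h => ⟨⟨s(x, y), by simpa using hxy⟩, by simpa using h, by simpa using ha⟩

theorem graphVerts_edgeGraph {x y : Fin n} (hxy : x ≠ y) : graphVerts (edgeGraph x y) = {x, y} := by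
  simpa using graphVerts_smul_edgeGraph hxy one_ne_zero

variable {K : Type*} [Field K]

theorem exists_isIsolated_of_card_lt {m : Multigraph n} (h : (graphVerts m).card < n) :
    ∃ v, IsIsolated m v := by
  have : ∃ v, v ∉ graphVerts m := by
    by_contra! h1
    rw [eq_univ_iff_forall.2 h1] at h
    simp at h
  exact this.imp fun v => notMem_graphVerts.1

/-- The transposition of the two ends is an automorphism, so both roots have the same rooted sum,
and a third vertex is isolated. -/
theorem good_smul_edgeGraph [CharZero K] (hn : 3 ≤ n) {x y : Fin n} (hxy : x ≠ y) (a : ℕ) :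
    Good K (a • edgeGraph x y) x := by
  rcases eq_or_ne a 0 with rfl | ha
  · rw [zero_smul]
    exact good_zero x
  have hV := graphVerts_smul_edgeGraph hxy ha
  obtain ⟨v, hv⟩ : ∃ v, IsIsolated (a • edgeGraph x y) v :=
    exists_isIsolated_of_card_lt (by rw [hV, card_pair hxy]; omega)
  refine good_of_forall hv (by rw [hV]; simp) fun u hu => Or.inr ?_
  have hinv : permGraph (Equiv.swap x u) (a • edgeGraph x y) = a • edgeGraph x y := by
    have h1 : permGraph (Equiv.swap x u) (a • edgeGraph x y) =
      a • permGraph (Equiv.swap x u) (edgeGraph x y) := rfl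
    rw [h1, permGraph_edgeGraph]
    rw [hV, mem_insert, mem_singleton] at hu
    rcases hu with rfl | rfl
    · simp
    · rw [Equiv.swap_apply_left, Equiv.swap_apply_right, edgeGraph_comm]
  conv_lhs => rw [← Equiv.swap_apply_left x u]
  exact rootedSum_eq_of_permGraph_eq K hinv

/-- A multigraph all of whose edges contain `c` is good at `c`. -/
theorem good_center [CharZero K] (hn : 3 ≤ n) {m : Multigraph n} {c : Fin n}
    (hm : ∀ e : Edge n, m e ≠ 0 → c ∈ e.1) : Good K m c := by
  classical
  let a : Fin n → ℕ := fun v => if h : c ≠ v then m ⟨s(c, v), by simpa using h⟩ else 0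
  have hma : m = ∑ v ∈ univ.erase c, a v • edgeGraph c v := by
    funext e
    rw [Finset.sum_apply]
    by_cases hc : c ∈ e.1
    · obtain ⟨v, hv⟩ := Sym2.mem_iff_exists.1 hc
      have hcv : c ≠ v := fun h => e.2 (by rw [hv, h]; simp)
      rw [sum_eq_single v]
      · have : e = ⟨s(c, v), by simpa using hcv⟩ := Subtype.ext hv
        subst this
        simp [a, hcv, edgeGraph]
      · intro w _ hwv
        have : e.1 ≠ s(c, w) := by
          rw [hv]
          intro h
          exact hwv (Sym2.congr_right.1 h).symm
        simp [edgeGraph, this]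
      · intro h
        simp [hcv.symm] at h
    · rw [not_not.1 (mt (hm e) hc)]
      refine (sum_eq_zero fun v _ => ?_).symm
      have : e.1 ≠ s(c, v) := fun h => hc (by rw [h]; simp)
      simp [edgeGraph, this]
  rw [hma]
  refine good_sum _ _ (fun v hv => good_smul_edgeGraph hn (ne_of_mem_erase hv).symm _) ?_
  intro i hi j hj hij v hvi hvj
  have key : ∀ i ∈ univ.erase c, v ∈ graphVerts (a i • edgeGraph c i) → v = c ∨ v = i := by
    intro i hi hvi
    rcases eq_or_ne (a i) 0 with h0 | h0
    · rw [h0, zero_smul, graphVerts_zero] at hvi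
      simp at hvi
    · rw [graphVerts_smul_edgeGraph (ne_of_mem_erase hi).symm h0] at hvi
      simpa using hvi
  rcases key i hi hvi with h | h
  · exact h
  · rcases key j hj hvj with h' | h'
    · exact h'
    · exact absurd (h.symm.trans h') hij

/-- The centre is already good, and transpositions of leaves make all leaves equivalent roots. -/
theorem good_star_leaf [CharZero K] (hn : 3 ≤ n) {c h : Fin n} {s : Finset (Fin n)}
    (hc : c ∉ s) (hh : h ∈ s) (hs : s.card + 1 < n) : Good K (∑ v ∈ s, edgeGraph c v) h := by
  have hne : ∀ v ∈ s, c ≠ v := fun v hv e => hc (e ▸ hv)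
  have hV : graphVerts (∑ v ∈ s, edgeGraph c v) = insert c s := by
    ext v
    rw [graphVerts_sum, mem_biUnion]
    constructor
    · rintro ⟨w, hw, hv⟩
      rw [graphVerts_edgeGraph (hne w hw), mem_insert, mem_singleton] at hv
      grind
    · intro hv
      rcases mem_insert.1 hv with rfl | hv
      · exact ⟨h, hh, by simp [graphVerts_edgeGraph (hne h hh)]⟩
      · exact ⟨v, hv, by simp [graphVerts_edgeGraph (hne v hv)]⟩
  obtain ⟨v, hv⟩ : ∃ v, IsIsolated (∑ v ∈ s, edgeGraph c v) v :=
    exists_isIsolated_of_card_lt (by rwa [hV, card_insert_of_notMem hc])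
  refine good_of_forall hv (by simp [hV, hh]) fun u hu => ?_
  rw [hV, mem_insert] at hu
  rcases hu with rfl | hu
  · left
    refine good_center hn fun e he => ?_
    by_contra hue
    apply he
    rw [Finset.sum_apply]
    refine sum_eq_zero fun v _ => ?_
    have : e.1 ≠ s(u, v) := fun h => hue (by rw [h]; simp)
    simp [edgeGraph, this]
  · right
    have hinv : permGraph (Equiv.swap h u) (∑ v ∈ s, edgeGraph c v) = ∑ v ∈ s, edgeGraph c v := by
      rw [permGraph_sum]
      refine sum_bij (fun v _ => Equiv.swap h u v) (fun v hv => ?_)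
        (fun _ _ _ _ h => (Equiv.swap _ _).injective h)
        (fun v hv => ⟨Equiv.swap h u v, ?_, by simp⟩) fun v _ => ?_
      · rw [Equiv.swap_apply_def]
        split_ifs <;> assumption
      · rw [Equiv.swap_apply_def]
        split_ifs <;> assumption
      · rw [permGraph_edgeGraph, Equiv.swap_apply_of_ne_of_ne (hne h hh) (hne u hu)]
    conv_lhs => rw [← Equiv.swap_apply_left h u]
    exact rootedSum_eq_of_permGraph_eq K hinv

/-- The path with the vertices `u a, u (a + 1), …, u b`. -/
def pathGraph (u : ℕ → Fin n) (a b : ℕ) : Multigraph n :=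
  ∑ i ∈ Ico a b, edgeGraph (u i) (u (i + 1))

theorem graphVerts_pathGraph_subset {u : ℕ → Fin n} {a b : ℕ} (hu : Set.InjOn u (Set.Icc a b))
    {v : Fin n} (hv : v ∈ graphVerts (pathGraph u a b)) : ∃ i ∈ Icc a b, u i = v := by
  rw [pathGraph, graphVerts_sum, mem_biUnion] at hv
  obtain ⟨i, hi, hv⟩ := hv
  rw [mem_Ico] at hi
  rw [graphVerts_edgeGraph, mem_insert, mem_singleton] at hv
  · rcases hv with rfl | rfl
    · exact ⟨i, mem_Icc.2 ⟨hi.1, by omega⟩, rfl⟩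
    · exact ⟨i + 1, mem_Icc.2 ⟨by omega, by omega⟩, rfl⟩
  · intro h
    have := hu ⟨hi.1, by omega⟩ ⟨by omega, by omega⟩ h
    omega

theorem graphVerts_pathGraph {u : ℕ → Fin n} {a b : ℕ} (hu : Set.InjOn u (Set.Icc a b))
    (hab : a < b) : graphVerts (pathGraph u a b) = (Icc a b).image u := by
  have hne : ∀ i, a ≤ i → i < b → u i ≠ u (i + 1) := fun i h1 h2 h => by
    have := hu ⟨h1, by omega⟩ ⟨by omega, by omega⟩ h
    omega
  ext v
  rw [mem_image]
  refine ⟨graphVerts_pathGraph_subset hu, ?_⟩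
  rintro ⟨i, hi, rfl⟩
  rw [mem_Icc] at hi
  rw [pathGraph, graphVerts_sum, mem_biUnion]
  by_cases hib : i < b
  · exact ⟨i, mem_Ico.2 ⟨hi.1, hib⟩, by simp [graphVerts_edgeGraph (hne i hi.1 hib)]⟩
  · obtain rfl : b = i := by omega
    refine ⟨b - 1, mem_Ico.2 ⟨by omega, by omega⟩, ?_⟩
    rw [graphVerts_edgeGraph (hne _ (by omega) (by omega)), Nat.sub_add_cancel (by omega)]
    simp

theorem rootedSum_pathGraph_reverse {u : ℕ → Fin n} {a b : ℕ} (hu : Set.InjOn u (Set.Icc a b))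
    (hab : a ≤ b) :
    rootedSum K (pathGraph u a b) (u b) = rootedSum K (pathGraph u a b) (u a) := by
  obtain ⟨π, hπ⟩ : ∃ π : Equiv.Perm (Fin n), ∀ i ∈ Set.Icc a b, π (u i) = u (a + b - i) := by
    obtain ⟨π, hπ⟩ := Equiv.Perm.exists_extending_pair (fun i : Set.Icc a b => u i)
      (fun i : Set.Icc a b => u (a + b - i)) hu.injective (by
        rintro ⟨i, hi⟩ ⟨j, hj⟩ hij
        rw [Set.mem_Icc] at hi hj
        have := hu ⟨by simp; omega, by simp; omega⟩ ⟨by simp; omega, by simp; omega⟩ hij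
        exact Subtype.ext (by simp at *; omega))
    exact ⟨π, fun i hi => hπ ⟨i, hi⟩⟩
  have hinv : permGraph π (pathGraph u a b) = pathGraph u a b := by
    rw [pathGraph, permGraph_sum]
    refine sum_bij' (fun i _ => a + b - 1 - i) (fun i _ => a + b - 1 - i) ?_ ?_ ?_ ?_ ?_ <;>
      intro i hi <;> rw [mem_Ico] at hi
    · exact mem_Ico.2 ⟨by omega, by omega⟩
    · exact mem_Ico.2 ⟨by omega, by omega⟩
    · omega
    · omega
    · rw [permGraph_edgeGraph, hπ i ⟨hi.1, by omega⟩, hπ (i + 1) ⟨by omega, by omega⟩,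
        edgeGraph_comm]
      congr 2 <;> omega
  rw [← rootedSum_eq_of_permGraph_eq K hinv, hπ b ⟨hab, le_rfl⟩, Nat.add_sub_cancel]

theorem pathGraph_add_pathGraph (u : ℕ → Fin n) {a i b : ℕ} (h1 : a ≤ i) (h2 : i ≤ b) :
    pathGraph u a i + pathGraph u i b = pathGraph u a b :=
  sum_Ico_consecutive _ h1 h2

theorem good_pathGraph_of_ends [CharZero K] {u : ℕ → Fin n} {a i b : ℕ}
    (hu : Set.InjOn u (Set.Icc a b))
    (hai : a ≤ i) (hib : i ≤ b) (h1 : Good K (pathGraph u a i) (u i))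
    (h2 : Good K (pathGraph u i b) (u i)) : Good K (pathGraph u a b) (u i) := by
  rw [← pathGraph_add_pathGraph u hai hib]
  refine h1.add h2 fun v hv hv' => ?_
  obtain ⟨j, hj, rfl⟩ :=
    graphVerts_pathGraph_subset (hu.mono (Set.Icc_subset_Icc le_rfl hib)) hv
  obtain ⟨k, hk, hjk⟩ :=
    graphVerts_pathGraph_subset (hu.mono (Set.Icc_subset_Icc hai le_rfl)) hv'
  rw [mem_Icc] at hj hk
  have := hu ⟨by omega, by omega⟩ ⟨by omega, by omega⟩ hjk
  rw [show j = i by omega]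

/-- Induction on the length `k`: an interior vertex is an end of two strictly shorter paths glued
there, hence good, and reversal makes the two ends equivalent. The path has `b - a + 1` vertices, so
one vertex stays isolated. -/
theorem good_pathGraph [CharZero K] (u : ℕ → Fin n) (k : ℕ) : ∀ a b : ℕ, b = a + k → b - a + 1 < n →
    Set.InjOn u (Set.Icc a b) →
      Good K (pathGraph u a b) (u a) ∧ Good K (pathGraph u a b) (u b) := by
  induction k using Nat.strong_induction_on with
  | _ k ih =>
    intro a b hb hn hu
    rcases Nat.eq_zero_or_pos k with rfl | hk
    · obtain rfl : b = a := by omega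
      have : pathGraph u b b = 0 := by simp [pathGraph]
      rw [this]
      exact ⟨good_zero _, good_zero _⟩
    have hab : a < b := by omega
    have hV := graphVerts_pathGraph hu hab
    have hcard : (graphVerts (pathGraph u a b)).card = b + 1 - a := by
      rw [hV, card_image_of_injOn (by simpa using hu), Nat.card_Icc]
    obtain ⟨v, hv⟩ := exists_isIsolated_of_card_lt (m := pathGraph u a b) (by omega)
    have hrev := rootedSum_pathGraph_reverse (K := K) hu hab.le
    have ha : u a ∈ graphVerts (pathGraph u a b) := by
      rw [hV]
      exact mem_image_of_mem _ (mem_Icc.2 ⟨le_rfl, hab.le⟩)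
    have hb' : u b ∈ graphVerts (pathGraph u a b) := by
      rw [hV]
      exact mem_image_of_mem _ (mem_Icc.2 ⟨hab.le, le_rfl⟩)
    have h1 : Good K (pathGraph u a b) (u a) := by
      refine good_of_forall hv ha fun x hx => ?_
      rw [hV, mem_image] at hx
      obtain ⟨i, hi, rfl⟩ := hx
      rw [mem_Icc] at hi
      rcases eq_or_ne i a with rfl | hia
      · exact Or.inr rfl
      rcases eq_or_ne i b with rfl | hib
      · exact Or.inr hrev
      left
      exact good_pathGraph_of_ends hu hi.1 hi.2
        (ih (i - a) (by omega) a i (by omega) (by omega)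
          (hu.mono (Set.Icc_subset_Icc le_rfl hi.2))).2
        (ih (b - i) (by omega) i b (by omega) (by omega)
          (hu.mono (Set.Icc_subset_Icc hi.1 le_rfl))).1
    exact ⟨h1, h1.congr ha hb' hrev.symm⟩

/-- The path may pass through all `n` vertices here: cut at an interior vertex, each half misses
one. -/
theorem good_pathGraph_interior [CharZero K] {u : ℕ → Fin n} {a i b : ℕ}
    (hu : Set.InjOn u (Set.Icc a b))
    (hai : a < i) (hib : i < b) (hn : b - a < n) : Good K (pathGraph u a b) (u i) :=
  good_pathGraph_of_ends hu hai.le hib.le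
    (good_pathGraph u (i - a) a i (by omega) (by omega)
      (hu.mono (Set.Icc_subset_Icc le_rfl hib.le))).2
    (good_pathGraph u (b - i) i b (by omega) (by omega)
      (hu.mono (Set.Icc_subset_Icc hai.le le_rfl))).1

end Pieces

/-! ### Trees of diameter at most four -/

section Trees

open SimpleGraph

variable {V : Type*} {G : SimpleGraph V}

/-- In a tree, a vertex `h` on the path from `u` to `v` lies, for each vertex `w`, on the path from
`w` to `u` or on the path from `w` to `v`. -/
theorem dist_eq_add_or_dist_eq_add (hG : G.IsTree) {u h v : V}
    (hd : G.dist u h + G.dist h v = G.dist u v) (w : V) :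
    G.dist u w = G.dist u h + G.dist h w ∨ G.dist w v = G.dist w h + G.dist h v := by
  classical
  have key : ∀ {x y : V} (p : G.Walk x y), p.length = G.dist x y → h ∈ p.support →
      G.dist x y = G.dist x h + G.dist h y := by
    intro x y p hp hh
    refine le_antisymm hG.1.dist_triangle ?_
    rw [← hp, ← p.take_spec hh, Walk.length_append]
    exact add_le_add (dist_le _) (dist_le _)
  obtain ⟨p₁, hp₁⟩ := hG.1.exists_walk_length_eq_dist u h
  obtain ⟨p₂, hp₂⟩ := hG.1.exists_walk_length_eq_dist h v
  obtain ⟨q₁, hq₁⟩ := hG.1.exists_walk_length_eq_dist u w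
  obtain ⟨q₂, hq₂⟩ := hG.1.exists_walk_length_eq_dist w v
  have hpath : (p₁.append p₂).IsPath :=
    Walk.isPath_of_length_eq_dist _ (by rw [Walk.length_append, hp₁, hp₂, hd])
  have heq : (p₁.append p₂) = (q₁.append q₂).bypass :=
    (hG.existsUnique_path u v).unique hpath (Walk.bypass_isPath _)
  -- The only path from `u` to `v` passes through `h`, so the detour through `w` does as well.
  have hmem : h ∈ (q₁.append q₂).support := by
    apply Walk.support_bypass_subset_support
    rw [← heq, Walk.mem_support_append_iff]
    exact Or.inl p₁.end_mem_support
  rw [Walk.mem_support_append_iff] at hmem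
  exact hmem.imp (key q₁ hq₁) (key q₂ hq₂)

/-- Take the vertex at distance `a` from one end of a path of length `diam`. A vertex too far from
it would be at distance more than `a + b` from one of the two ends. -/
theorem exists_forall_dist_le [Finite V] (hG : G.IsTree) {a b : ℕ} (hab : G.diam = a + b) :
    ∃ h, ∀ w, G.dist h w ≤ max a b := by
  have := hG.1.nonempty
  have htop : G.ediam ≠ ⊤ := connected_iff_ediam_ne_top.1 hG.1
  obtain ⟨u, v, huv⟩ := G.exists_dist_eq_diam
  obtain ⟨p, hp⟩ := hG.1.exists_walk_length_eq_dist u v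
  have h1 : G.dist u (p.getVert a) ≤ a := by
    refine (dist_le (p.take a)).trans ?_
    rw [Walk.take_length]
    exact min_le_left _ _
  have h2 : G.dist (p.getVert a) v ≤ b := by
    refine (dist_le (p.drop a)).trans ?_
    rw [Walk.drop_length]
    omega
  have h3 : G.dist u v ≤ G.dist u (p.getVert a) + G.dist (p.getVert a) v := hG.1.dist_triangle
  refine ⟨p.getVert a, fun w => ?_⟩
  have h4 : G.dist u w ≤ G.diam := dist_le_diam htop
  have h5 : G.dist w v ≤ G.diam := dist_le_diam htop
  have h6 : G.dist w (p.getVert a) = G.dist (p.getVert a) w := dist_comm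
  rcases dist_eq_add_or_dist_eq_add hG (u := u) (h := p.getVert a) (v := v) (by omega) w with h | h
  · exact le_max_of_le_right (by omega)
  · exact le_max_of_le_left (by omega)

/-- The subgraph of all edges containing `c`. -/
def starAt (G : SimpleGraph V) (c : V) : G.Subgraph where
  verts := insert c (G.neighborSet c)
  Adj a b := G.Adj a b ∧ (a = c ∨ b = c)
  adj_sub h := h.1
  edge_vert := by
    rintro a b ⟨h, rfl | rfl⟩
    · exact Set.mem_insert _ _
    · exact Set.mem_insert_of_mem _ h.symm
  symm := ⟨fun a b h => ⟨h.1.symm, h.2.symm⟩⟩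

theorem mem_verts_starAt {c v : V} : v ∈ (starAt G c).verts ↔ v = c ∨ G.Adj c v := Iff.rfl

theorem isTree_coe_starAt (hG : G.IsTree) (c : V) : (starAt G c).coe.IsTree := by
  refine ⟨?_, hG.2.subgraph _⟩
  have hc : c ∈ (starAt G c).verts := Or.inl rfl
  have hr : ∀ x : (starAt G c).verts, (starAt G c).coe.Reachable ⟨c, hc⟩ x := by
    rintro ⟨x, rfl | hx⟩
    · rfl
    · exact SimpleGraph.Adj.reachable (Subgraph.coe_adj _ _ _ ▸ ⟨hx, Or.inl rfl⟩)
  exact { preconnected := fun x y => (hr x).symm.trans (hr y), nonempty := ⟨⟨c, hc⟩⟩ }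

theorem isStarThrough_starAt [Finite V] (hG : G.IsTree) {c h x : V} (hh : G.Adj h c)
    (hx : G.Adj c x) (hxh : x ≠ h) : IsStarThrough h (starAt G c) := by
  have hT := isTree_coe_starAt hG c
  have : Nonempty (starAt G c).verts := hT.1.nonempty
  have hhv : h ∈ (starAt G c).verts := Or.inr hh.symm
  have hcv : c ∈ (starAt G c).verts := Or.inl rfl
  have hxv : x ∈ (starAt G c).verts := Or.inr hx
  refine ⟨hhv, hT, le_antisymm ?_ ?_⟩
  · obtain ⟨u, v, huv⟩ := (starAt G c).coe.exists_dist_eq_diam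
    have h1 : ∀ u, (starAt G c).coe.dist ⟨c, hcv⟩ u ≤ 1 := by
      rintro ⟨u, rfl | hu⟩
      · simp
      · exact (dist_eq_one_iff_adj.2 (Subgraph.coe_adj _ _ _ ▸ ⟨hu, Or.inl rfl⟩)).le
    have h2 : (starAt G c).coe.dist u v ≤
        (starAt G c).coe.dist u ⟨c, hcv⟩ + (starAt G c).coe.dist ⟨c, hcv⟩ v := hT.1.dist_triangle
    have h3 := h1 u
    have h4 := h1 v
    rw [dist_comm] at h3
    omega
  · have h1 : 1 < (starAt G c).coe.dist ⟨h, hhv⟩ ⟨x, hxv⟩ := by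
      refine hT.1.one_lt_dist_of_ne_of_not_adj (fun e => hxh (congrArg Subtype.val e).symm) ?_
      rintro ⟨-, e | e⟩
      · exact hh.ne e
      · exact hx.ne e.symm
    have h2 : (starAt G c).coe.dist ⟨h, hhv⟩ ⟨x, hxv⟩ ≤ (starAt G c).coe.diam :=
      dist_le_diam (connected_iff_ediam_ne_top.1 hT.1)
    omega

theorem isPathFrom_starAt {c h : V} (hh : G.Adj h c) (hx : ∀ x, G.Adj c x → x = h) :
    IsPathFrom h (starAt G c) := by
  refine ⟨c, Walk.cons hh Walk.nil, by simpa using hh.ne, ?_⟩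
  refine Subgraph.ext (Set.ext fun v => ?_) (funext fun a => funext fun b => propext ?_)
  · rw [mem_verts_starAt, Walk.mem_verts_toSubgraph]
    have := hx v
    have := hh.symm
    simp
    grind
  · rw [Walk.adj_toSubgraph_iff_mem_edges]
    have h1 := hx a
    have h2 := hx b
    have h3 := hh.symm
    have h4 := G.adj_comm a b
    change (G.Adj a b ∧ (a = c ∨ b = c)) ↔ _
    simp
    grind

theorem adj_unique_of_adj_of_adj (hG : G.IsTree) {h w c c' : V} (hw : w ≠ h) (h1 : G.Adj h c)
    (h2 : G.Adj c w) (h3 : G.Adj h c') (h4 : G.Adj c' w) : c = c' := by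
  have := (hG.existsUnique_path h w).unique (y₁ := Walk.cons h1 (Walk.cons h2 Walk.nil))
    (y₂ := Walk.cons h3 (Walk.cons h4 Walk.nil)) (by simp [h1.ne, h2.ne, hw.symm])
    (by simp [h3.ne, h4.ne, hw.symm])
  simpa using congrArg (fun p => p.getVert 1) this

/-- The blocks are the stars centred at the neighbours `c` of `h`: a single edge if `c` is a leaf,
of diameter `2` otherwise. They meet only at `h` by uniqueness of paths in a tree. -/
theorem isStarredOctopus_of_forall_dist_le [Finite V] (hG : G.IsTree) {h : V}
    (hh : ∀ w, G.dist h w ≤ 2) : IsStarredOctopus G := by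
  have hadj : ∀ {w}, G.dist h w = 1 → G.Adj h w := dist_eq_one_iff_adj.1
  have hcov : ∀ w, w = h ∨ ∃ c, G.Adj h c ∧ w ∈ (starAt G c).verts := by
    intro w
    obtain ⟨p, hp⟩ := hG.1.exists_walk_length_eq_dist h w
    have := hh w
    match p, hp with
    | .nil, _ => exact Or.inl rfl
    | .cons e .nil, _ => exact Or.inr ⟨_, e, Or.inl rfl⟩
    | .cons e (.cons e' .nil), _ => exact Or.inr ⟨_, e, Or.inr e'⟩
    | .cons e (.cons e' (.cons e'' q)), hp =>
      simp only [Walk.length_cons] at hp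
      omega
  have hone : ∀ {a b}, G.Adj a b → G.dist h a ≤ 1 → ∃ c, G.Adj h c ∧ (starAt G c).Adj a b := by
    intro a b hab ha
    rcases Nat.le_one_iff_eq_zero_or_eq_one.1 ha with ha | ha
    · rw [hG.1.dist_eq_zero_iff] at ha
      subst ha
      exact ⟨b, hab, hab, Or.inr rfl⟩
    · exact ⟨a, hadj ha, hab, Or.inl rfl⟩
  have hnil : (Walk.nil : G.Walk h h).toSubgraph.verts = {h} := by simp
  have hhead : ∀ {c}, G.Adj h c → h ∈ (starAt G c).verts := fun hc => Or.inr hc.symm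
  -- The trivial path covers `h` when the tree has only one vertex.
  refine ⟨hG, h, insert (Walk.nil : G.Walk h h).toSubgraph (starAt G '' G.neighborSet h),
    ⟨?_, ?_⟩, ?_⟩
  · rintro B (rfl | ⟨c, hc, rfl⟩) C (rfl | ⟨c', hc', rfl⟩) hBC
    · exact absurd rfl hBC
    · rw [hnil]
      exact Set.inter_eq_left.2 (Set.singleton_subset_iff.2 (hhead hc'))
    · rw [hnil]
      exact Set.inter_eq_right.2 (Set.singleton_subset_iff.2 (hhead hc))
    · have hne : c ≠ c' := fun e => hBC (by rw [e])
      have hd : G.dist h c = G.dist h c' := by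
        rw [dist_eq_one_iff_adj.2 hc, dist_eq_one_iff_adj.2 hc']
      refine Set.Subset.antisymm ?_ (Set.singleton_subset_iff.2 ⟨hhead hc, hhead hc'⟩)
      rintro w ⟨hw | hw, hw' | hw'⟩
      · exact absurd (hw.symm.trans hw') hne
      · rw [hw] at hw'
        exact absurd hd.symm (hG.dist_ne_of_adj h hw')
      · rw [hw'] at hw
        exact absurd hd (hG.dist_ne_of_adj h hw)
      · by_contra hwh
        exact hne (adj_unique_of_adj_of_adj hG hwh hc hw hc' hw')
  · refine Subgraph.ext (Set.ext fun w => ?_) (funext fun a => funext fun b => propext ?_)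
    · simp only [Subgraph.verts_sSup, Subgraph.verts_top, Set.mem_univ, iff_true, Set.mem_iUnion]
      rcases hcov w with rfl | ⟨c, hc, hw⟩
      · exact ⟨_, Set.mem_insert _ _, by simp⟩
      · exact ⟨_, Set.mem_insert_of_mem _ ⟨c, hc, rfl⟩, hw⟩
    · rw [Subgraph.sSup_adj, Subgraph.top_adj]
      refine ⟨fun ⟨B, _, hB⟩ => B.adj_sub hB, fun hab => ?_⟩
      -- Adjacent vertices have different distances from `h`, both at most `2`, so one of them is
      -- within distance `1`.
      have h1 := hG.dist_ne_of_adj h hab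
      have h2 := hh a
      have h3 := hh b
      by_cases ha : G.dist h a ≤ 1
      · obtain ⟨c, hc, hcab⟩ := hone hab ha
        exact ⟨_, Set.mem_insert_of_mem _ ⟨c, hc, rfl⟩, hcab⟩
      · obtain ⟨c, hc, hcab⟩ := hone hab.symm (by omega)
        exact ⟨_, Set.mem_insert_of_mem _ ⟨c, hc, rfl⟩, hcab.symm⟩
  · rintro B (rfl | ⟨c, hc, rfl⟩)
    · exact Or.inl ⟨h, Walk.nil, Walk.IsPath.nil, rfl⟩
    · by_cases hx : ∃ x, G.Adj c x ∧ x ≠ h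
      · obtain ⟨x, hx, hxh⟩ := hx
        exact Or.inr (isStarThrough_starAt hG hc hx hxh)
      · push Not at hx
        exact Or.inl (isPathFrom_starAt hc hx)

theorem isStarredOctopus_of_diam_le_four [Finite V] (hG : G.IsTree) (hd : G.diam ≤ 4) :
    IsStarredOctopus G := by
  obtain ⟨h, hh⟩ := exists_forall_dist_le hG (a := G.diam / 2) (b := G.diam - G.diam / 2) (by omega)
  exact isStarredOctopus_of_forall_dist_le hG fun w => (hh w).trans (max_le (by omega) (by omega))

/-- The edges of a star all contain one vertex, its centre. -/
theorem exists_center_of_diam_eq_two [Finite V] (hG : G.IsTree) (hd : G.diam = 2) :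
    ∃ c, ∀ a b, G.Adj a b ↔ a ≠ b ∧ (a = c ∨ b = c) := by
  obtain ⟨c, hc⟩ := exists_forall_dist_le hG (a := 1) (b := 1) hd
  have hadj : ∀ w, w ≠ c → G.Adj c w := fun w hw => by
    have h1 := hG.1.pos_dist_of_ne hw.symm
    have h2 := hc w
    exact dist_eq_one_iff_adj.1 (by simp at h2; omega)
  refine ⟨c, fun a b => ⟨fun hab => ⟨hab.ne, ?_⟩, ?_⟩⟩
  · by_contra! h
    apply hG.dist_ne_of_adj c hab
    rw [dist_eq_one_iff_adj.2 (hadj a h.1), dist_eq_one_iff_adj.2 (hadj b h.2)]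
  · rintro ⟨hne, rfl | rfl⟩
    · exact hadj b hne.symm
    · exact (hadj a hne).symm

end Trees

/-! ### Decomposition of starred octopuses into good blocks -/

section Blocks

variable {n : ℕ} {G : SimpleGraph (Fin n)}

theorem exists_eq_mk (e : Edge n) : ∃ x y, e.1 = s(x, y) := by
  induction e.1 using Sym2.ind with
  | _ x y => exact ⟨x, y, rfl⟩

/-- A subgraph of a simple graph, seen as a multigraph. -/
noncomputable def ofSubgraph (B : G.Subgraph) : Multigraph n := ofSimpleGraph B.spanningCoe

theorem ofSubgraph_apply_of_adj {B : G.Subgraph} {x y : Fin n} {e : Edge n} (he : e.1 = s(x, y))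
    (h : B.Adj x y) : ofSubgraph B e = 1 := by
  rw [ofSubgraph, ofSimpleGraph, if_pos]
  rwa [he]

theorem ofSubgraph_apply_of_not_adj {B : G.Subgraph} {x y : Fin n} {e : Edge n}
    (he : e.1 = s(x, y)) (h : ¬ B.Adj x y) : ofSubgraph B e = 0 := by
  rw [ofSubgraph, ofSimpleGraph, if_neg]
  rwa [he]

theorem mem_verts_of_mem_graphVerts {B : G.Subgraph} {v : Fin n}
    (hv : v ∈ graphVerts (ofSubgraph B)) : v ∈ B.verts := by
  obtain ⟨e, hve, he⟩ := mem_graphVerts.1 hv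
  obtain ⟨w, hw⟩ := Sym2.mem_iff_exists.1 hve
  by_contra h
  exact he (ofSubgraph_apply_of_not_adj hw fun hadj => h (B.edge_vert hadj))

/-- No edge is counted twice, since two blocks sharing an edge would share two vertices. -/
theorem ofSimpleGraph_eq_sum {h : Fin n} {𝓑 : Set G.Subgraph} (hB : IsGluedAt h 𝓑)
    (s : Finset G.Subgraph) (hs : ∀ B, B ∈ s ↔ B ∈ 𝓑) :
    ofSimpleGraph G = ∑ B ∈ s, ofSubgraph B := by
  classical
  funext e
  rw [Finset.sum_apply]
  obtain ⟨x, y, hxy⟩ : ∃ x y, e.1 = s(x, y) := exists_eq_mk e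
  have hne : x ≠ y := fun h => e.2 (by rw [hxy, h]; simp)
  by_cases hG : G.Adj x y
  · have h1 : (sSup 𝓑).Adj x y := by rw [hB.2]; exact hG
    obtain ⟨B, hBB, hadj⟩ := SimpleGraph.Subgraph.sSup_adj.1 h1
    rw [sum_eq_single B, ofSubgraph_apply_of_adj hxy hadj, ofSimpleGraph, if_pos (by rwa [hxy])]
    · intro C hC hCB
      refine ofSubgraph_apply_of_not_adj hxy fun hadj' => hne ?_
      have h2 := hB.1 ((hs C).1 hC) hBB hCB
      have h3 : x ∈ C.verts ∩ B.verts := ⟨C.edge_vert hadj', B.edge_vert hadj⟩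
      have h4 : y ∈ C.verts ∩ B.verts := ⟨C.edge_vert hadj'.symm, B.edge_vert hadj.symm⟩
      rw [h2] at h3 h4
      exact h3.trans h4.symm
    · exact fun h => absurd ((hs B).2 hBB) h
  · rw [ofSimpleGraph, if_neg (by rwa [hxy])]
    exact (sum_eq_zero fun B _ =>
      ofSubgraph_apply_of_not_adj hxy fun hadj => hG (B.adj_sub hadj)).symm

theorem ofSubgraph_toSubgraph {x y : Fin n} {p : G.Walk x y} (hp : p.IsPath) :
    ofSubgraph p.toSubgraph = pathGraph p.getVert 0 p.length := by
  funext e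
  obtain ⟨a, b, hab⟩ : ∃ a b, e.1 = s(a, b) := exists_eq_mk e
  rw [pathGraph, Finset.sum_apply]
  by_cases hadj : p.toSubgraph.Adj a b
  · rw [ofSubgraph_apply_of_adj hab hadj]
    obtain ⟨i, hi, hip⟩ := p.toSubgraph_adj_iff.1 hadj
    rw [sum_eq_single i]
    · simp [edgeGraph, hab, hi]
    · intro j hj hji
      rw [edgeGraph, if_neg]
      rw [hab, ← hi, Sym2.eq_iff]
      have hinj : ∀ k l, k ≤ p.length → l ≤ p.length → p.getVert k = p.getVert l → k = l :=
        fun k l hk hl h => hp.getVert_injOn hk hl h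
      rw [mem_Ico] at hj
      rintro (⟨h1, h2⟩ | ⟨h1, h2⟩)
      · exact hji (hinj _ _ (by omega) (by omega) h1).symm
      · have := hinj _ _ (by omega) (by omega) h1
        have := hinj _ _ (by omega) (by omega) h2
        omega
    · exact fun h => absurd (mem_Ico.2 ⟨Nat.zero_le _, hip⟩) h
  · rw [ofSubgraph_apply_of_not_adj hab hadj]
    refine (sum_eq_zero fun i hi => ?_).symm
    rw [edgeGraph, if_neg]
    intro h
    rw [mem_Ico] at hi
    exact hadj (p.toSubgraph_adj_iff.2 ⟨i, by rw [← h, hab], hi.2⟩)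

theorem injOn_getVert {x y : Fin n} {p : G.Walk x y} (hp : p.IsPath) :
    Set.InjOn p.getVert (Set.Icc 0 p.length) :=
  hp.getVert_injOn.mono fun _ hi => hi.2

theorem exists_center_of_isStarThrough {h : Fin n} {B : G.Subgraph} (hB : IsStarThrough h B) :
    ∃ c ∈ B.verts, ∀ a ∈ B.verts, ∀ b ∈ B.verts, B.Adj a b ↔ a ≠ b ∧ (a = c ∨ b = c) := by
  obtain ⟨c, hc⟩ := exists_center_of_diam_eq_two hB.2.1 hB.2.2
  refine ⟨c, c.2, fun a ha b hb => ?_⟩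
  have := hc ⟨a, ha⟩ ⟨b, hb⟩
  simpa [Subtype.ext_iff] using this

theorem mem_of_center {B : G.Subgraph} {c : Fin n}
    (hc : ∀ a ∈ B.verts, ∀ b ∈ B.verts, B.Adj a b ↔ a ≠ b ∧ (a = c ∨ b = c)) (e : Edge n)
    (he : ofSubgraph B e ≠ 0) : c ∈ e.1 := by
  obtain ⟨x, y, hxy⟩ := exists_eq_mk e
  have hadj : B.Adj x y := by
    by_contra h
    exact he (ofSubgraph_apply_of_not_adj hxy h)
  have := ((hc x (B.edge_vert hadj) y (B.edge_vert hadj.symm)).1 hadj).2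
  rw [hxy, Sym2.mem_iff]
  exact this.imp Eq.symm Eq.symm

theorem ofSubgraph_eq_sum_of_center {B : G.Subgraph} [DecidablePred (· ∈ B.verts)] {c : Fin n}
    (hcB : c ∈ B.verts)
    (hc : ∀ a ∈ B.verts, ∀ b ∈ B.verts, B.Adj a b ↔ a ≠ b ∧ (a = c ∨ b = c)) :
    ofSubgraph B = ∑ v ∈ (univ.filter (· ∈ B.verts)).erase c, edgeGraph c v := by
  funext e
  rw [Finset.sum_apply]
  by_cases hce : c ∈ e.1
  · obtain ⟨w, hw⟩ := Sym2.mem_iff_exists.1 hce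
    have hcw : c ≠ w := fun h => e.2 (by rw [hw, h]; simp)
    have hval : ∀ v, edgeGraph c v e = if v = w then 1 else 0 := fun v => by
      rw [edgeGraph, hw]
      exact if_congr (Sym2.congr_right.trans eq_comm) rfl rfl
    simp only [hval, sum_ite_eq']
    by_cases hwB : w ∈ B.verts
    · rw [if_pos (by simp [hwB, hcw.symm])]
      exact ofSubgraph_apply_of_adj hw ((hc c hcB w hwB).2 ⟨hcw, Or.inl rfl⟩)
    · rw [if_neg (by simp [hwB])]
      exact ofSubgraph_apply_of_not_adj hw fun h => hwB (B.edge_vert h.symm)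
  · rw [not_not.1 (mt (mem_of_center hc e) hce)]
    refine (sum_eq_zero fun v _ => ?_).symm
    have : e.1 ≠ s(c, v) := fun h => hce (by rw [h]; simp)
    simp [edgeGraph, this]

variable {K : Type*} [Field K] [CharZero K]

theorem good_of_isPathFrom {h : Fin n} {B : G.Subgraph} (hB : IsPathFrom h B)
    (hv : B.verts ≠ Set.univ) : Good K (ofSubgraph B) h := by
  obtain ⟨u, p, hp, rfl⟩ := hB
  rw [ofSubgraph_toSubgraph hp]
  have hlt : p.support.toFinset.card < n := by
    by_contra hle
    apply hv
    have h1 := eq_univ_of_card p.support.toFinset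
      (le_antisymm (card_le_univ _) (by simpa using not_lt.1 hle))
    refine Set.eq_univ_of_forall fun v => ?_
    rw [SimpleGraph.Walk.mem_verts_toSubgraph, ← List.mem_toFinset, h1]
    exact mem_univ v
  rw [List.toFinset_card_of_nodup hp.support_nodup, SimpleGraph.Walk.length_support] at hlt
  have := (good_pathGraph (K := K) p.getVert p.length 0 p.length (by omega) (by omega)
    (injOn_getVert hp)).1
  rwa [SimpleGraph.Walk.getVert_zero] at this

theorem exists_good_of_isPathFrom (hn : 3 ≤ n) {h : Fin n} {B : G.Subgraph} (hB : IsPathFrom h B)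
    (hv : B.verts = Set.univ) : ∃ c, Good K (ofSubgraph B) c := by
  obtain ⟨u, p, hp, rfl⟩ := hB
  rw [ofSubgraph_toSubgraph hp]
  have hcard : p.support.toFinset.card = n := by
    have h1 : p.support.toFinset = univ := by
      refine eq_univ_iff_forall.2 fun v => ?_
      rw [List.mem_toFinset, ← SimpleGraph.Walk.mem_verts_toSubgraph, hv]
      exact Set.mem_univ v
    rw [h1, card_univ, Fintype.card_fin]
  rw [List.toFinset_card_of_nodup hp.support_nodup, SimpleGraph.Walk.length_support] at hcard
  -- With at least three vertices, the second vertex of the path is interior.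
  exact ⟨_, good_pathGraph_interior (i := 1) (injOn_getVert hp) (by omega) (by omega) (by omega)⟩

theorem good_of_isStarThrough (hn : 3 ≤ n) {h : Fin n} {B : G.Subgraph} (hB : IsStarThrough h B)
    (hv : B.verts ≠ Set.univ) : Good K (ofSubgraph B) h := by
  classical
  obtain ⟨c, hcB, hc⟩ := exists_center_of_isStarThrough hB
  by_cases hch : h = c
  · subst hch
    exact good_center hn (mem_of_center hc)
  · rw [ofSubgraph_eq_sum_of_center hcB hc]
    refine good_star_leaf hn (notMem_erase _ _) (by simp [hch, hB.1]) ?_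
    rw [card_erase_add_one (by simpa using hcB)]
    by_contra hle
    apply hv
    have h1 := eq_univ_of_card (univ.filter (· ∈ B.verts))
      (le_antisymm (card_le_univ _) (by simpa using not_lt.1 hle))
    exact Set.eq_univ_of_forall fun v => by simpa using eq_univ_iff_forall.1 h1 v

theorem exists_good_of_isStarredOctopus (hn : 3 ≤ n) (hG : IsStarredOctopus G) :
    ∃ c, Good K (ofSimpleGraph G) c := by
  classical
  obtain ⟨-, h, 𝓑, hglue, hB⟩ := hG
  set s : Finset G.Subgraph := (Set.toFinite 𝓑).toFinset with hs_def
  have hs : ∀ B, B ∈ s ↔ B ∈ 𝓑 := fun B => Set.Finite.mem_toFinset _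
  have hsum := ofSimpleGraph_eq_sum hglue s hs
  -- The head is a usable root when every block misses a vertex. If some block spans, all other
  -- blocks reduce to the single vertex `h`, and the root is moved inside the spanning block.
  by_cases hall : ∃ B ∈ s, B.verts = Set.univ
  · obtain ⟨B, hBs, hBv⟩ := hall
    have heq : ofSimpleGraph G = ofSubgraph B := by
      rw [hsum]
      refine sum_eq_single_of_mem B hBs fun C hC hCB => ?_
      have h1 : C.verts ∩ B.verts = {h} := hglue.1 ((hs C).1 hC) ((hs B).1 hBs) hCB
      rw [hBv, Set.inter_univ] at h1
      funext e
      by_contra he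
      obtain ⟨x, y, hxy⟩ : ∃ x y, e.1 = s(x, y) := exists_eq_mk e
      refine he (ofSubgraph_apply_of_not_adj hxy fun hadj => hadj.ne ?_)
      have h2 := C.edge_vert hadj
      have h3 := C.edge_vert hadj.symm
      rw [h1] at h2 h3
      exact h2.trans h3.symm
    rw [heq]
    rcases hB B ((hs B).1 hBs) with h1 | h1
    · exact exists_good_of_isPathFrom hn h1 hBv
    · obtain ⟨c, hcB, hc⟩ := exists_center_of_isStarThrough h1
      exact ⟨c, good_center hn (mem_of_center hc)⟩
  · push Not at hall
    rw [hsum]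
    refine ⟨h, good_sum _ _ (fun B hBs => ?_) ?_⟩
    · rcases hB B ((hs B).1 hBs) with h1 | h1
      · exact good_of_isPathFrom h1 (hall B hBs)
      · exact good_of_isStarThrough hn h1 (hall B hBs)
    · intro B hBs C hCs hBC v hvB hvC
      have h1 : B.verts ∩ C.verts = {h} := hglue.1 ((hs B).1 hBs) ((hs C).1 hCs) hBC
      have h2 : v ∈ B.verts ∩ C.verts :=
        ⟨mem_verts_of_mem_graphVerts hvB, mem_verts_of_mem_graphVerts hvC⟩
      rw [h1] at h2
      exact h2

theorem IsOctopus.isStarredOctopus {V : Type*} {G : SimpleGraph V} (hG : IsOctopus G) :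
    IsStarredOctopus G :=
  ⟨hG.1, hG.2.imp fun _ ⟨𝓑, h1, h2⟩ => ⟨𝓑, h1, fun B hB => Or.inl (h2 B hB)⟩⟩

end Blocks

end AlgRec

theorem mainTheorem4 (K : Type*) [Field K] [CharZero K] (n : ℕ) (hn : 3 ≤ n) :
    (∀ m : AlgRec.Multigraph n,
      (∃ v : Fin n, ∀ e : AlgRec.Edge n, m e ≠ 0 → v ∈ e.1) →
        AlgRec.IsAlgReconstructible K m) ∧
    (∀ G : SimpleGraph (Fin n), AlgRec.IsOctopus G →
      AlgRec.IsAlgReconstructible K (AlgRec.ofSimpleGraph G)) ∧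
    (∀ G : SimpleGraph (Fin n), AlgRec.IsStarredOctopus G →
      AlgRec.IsAlgReconstructible K (AlgRec.ofSimpleGraph G)) ∧
    (∀ (k : ℕ) (T : SimpleGraph (Fin k)), T.IsTree → T.diam ≤ 4 →
      AlgRec.IsStarredOctopus T) := by
  have hstarred : ∀ G : SimpleGraph (Fin n), AlgRec.IsStarredOctopus G →
      AlgRec.IsAlgReconstructible K (AlgRec.ofSimpleGraph G) := fun G hG => by
    obtain ⟨c, hc⟩ := AlgRec.exists_good_of_isStarredOctopus (K := K) hn hG
    exact hc.isAlgReconstructible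
  refine ⟨fun m ⟨v, hv⟩ => (AlgRec.good_center hn hv).isAlgReconstructible,
    fun G hG => hstarred G hG.isStarredOctopus, hstarred,
    fun k T hT hd => AlgRec.isStarredOctopus_of_diam_le_four hT hd⟩
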